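/- Let $K$ be a field of characteristic different from $2$ and let $X=Y\cup Z$, where $Y=\{y_1,y_2,\ldots\}$ is a countably infinite set of even generators and $Z=\{z_1,z_2,\ldots\}$ is a countably infinite set of odd generators. Let $F$ be the free super-commutative algebra on $X$, i.e. the unital associative $K$-algebra generated by $X$ with defining relations $xy=yx$ ($x\in X$, $y\in Y$) and $zz'=-z'z$ ($z,z'\in Z$), with its $\mathbb Z_2$-grading (the parity of a homogeneous element $a$ is denoted $\overline a$), and let $\omega\subset F$ be its augmentation ideal (the elements without constant term). Let $G_{\mathrm{sup}}(X)=KX\oplus(\omega\otimes_K\omega)$, with the bilinear multiplication $\circ$ given, for $x,x'\in X$ and homogeneous $u,v,u_1,v_1,u_2,v_2\in\omega$, by \[ x\circ x'=x\otimes x',\qquad x\circ(u\otimes v)=(xu)\otimes v,\qquad (u\otimes v)\circ x=u\otimes(vx), \] \[ (u_1\otimes v_1)\circ(u_2\otimes v_2)=(-1)^{\overline{v_1}(\overline{u_2}+\overline{v_2})}(u_1u_2)\otimes(v_2v_1). \] Let $\Phi_Y=\Phi_Z$ be the semigroup of all strictly increasing maps of the set of indices $\{1,2,\ldots\}$ into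 itself, and let $\Phi=\Phi_Y\times\Phi_Z$ act on $G_{\mathrm{sup}}(X)$ by the algebra endomorphisms with $(\varphi,\psi)(y_i)=y_{\varphi(i)}$, $(\varphi,\psi)(z_i)=z_{\psi(i)}$. A $\Phi$-ideal of $G_{\mathrm{sup}}(X)$ is a two-sided ideal (a $K$-subspace closed under left and right multiplication by all elements of $G_{\mathrm{sup}}(X)$) that is mapped into itself by every element of $\Phi$. Then every $\Phi$-ideal $I$ of $G_{\mathrm{sup}}(X)$ is finitely generated as a $\Phi$-ideal: there is a finite set $S\subseteq I$ such that $I$ is the smallest $\Phi$-ideal of $G_{\mathrm{sup}}(X)$ that contains $S$. -/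

import Mathlib

open scoped TensorProduct

noncomputable section

namespace Bicommutative

/-- The free generators: `Sum.inl i` is the even generator `y_i`,
`Sum.inr i` is the odd generator `z_i` (indices start at `0`). -/
abbrev Gen : Type := ℕ ⊕ ℕ

section

variable (K : Type*) [Field K]

/-- The defining relations `x y = y x` (`x` any generator, `y` even) and `z z' = - z' z`
(`z`, `z'` odd, possibly equal) of the free super-commutative algebra. -/
inductive SuperCommRel : FreeAlgebra K Gen → FreeAlgebra K Gen → Prop
  | even (x : Gen) (i : ℕ) :
      SuperCommRel (FreeAlgebra.ι K x * FreeAlgebra.ι K (Sum.inl i))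
        (FreeAlgebra.ι K (Sum.inl i) * FreeAlgebra.ι K x)
  | odd (i j : ℕ) :
      SuperCommRel (FreeAlgebra.ι K (Sum.inr i) * FreeAlgebra.ι K (Sum.inr j))
        (-(FreeAlgebra.ι K (Sum.inr j) * FreeAlgebra.ι K (Sum.inr i)))

/-- The free (unital, associative) super-commutative algebra on the generators `y_i`, `z_i`. -/
def FreeSuperComm : Type _ := RingQuot (SuperCommRel K)

instance : Ring (FreeSuperComm K) := inferInstanceAs (Ring (RingQuot (SuperCommRel K)))

instance : Algebra K (FreeSuperComm K) :=
  inferInstanceAs (Algebra K (RingQuot (SuperCommRel K)))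

/-- The quotient map from the free associative algebra. -/
def mk : FreeAlgebra K Gen →ₐ[K] FreeSuperComm K := RingQuot.mkAlgHom K (SuperCommRel K)

/-- The generators of the free super-commutative algebra. -/
def gen (x : Gen) : FreeSuperComm K :=
  mk K (FreeAlgebra.ι K x)

variable {K}

lemma mk_rel {a b : FreeAlgebra K Gen} (h : SuperCommRel K a b) : mk K a = mk K b :=
  RingQuot.mkAlgHom_rel K h

lemma gen_even_comm (x : Gen) (i : ℕ) :
    gen K x * gen K (Sum.inl i) = gen K (Sum.inl i) * gen K x := by
  simpa [gen] using mk_rel (SuperCommRel.even (K := K) x i)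

lemma gen_odd_anticomm (i j : ℕ) :
    gen K (Sum.inr i) * gen K (Sum.inr j) = -(gen K (Sum.inr j) * gen K (Sum.inr i)) := by
  simpa [gen] using mk_rel (SuperCommRel.odd (K := K) i j)

/-- The universal property: images of the generators satisfying the defining relations
extend to an algebra homomorphism. -/
def lift {A : Type*} [Ring A] [Algebra K A] (f : Gen → A)
    (he : ∀ x i, f x * f (Sum.inl i) = f (Sum.inl i) * f x)
    (ho : ∀ i j, f (Sum.inr i) * f (Sum.inr j) = -(f (Sum.inr j) * f (Sum.inr i))) :
    FreeSuperComm K →ₐ[K] A :=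
  RingQuot.liftAlgHom K ⟨FreeAlgebra.lift K f, by
    intro a b h
    cases h with
    | even x i => simpa using he x i
    | odd i j => simpa using ho i j⟩

@[simp] lemma lift_gen {A : Type*} [Ring A] [Algebra K A] (f : Gen → A)
    (he : ∀ x i, f x * f (Sum.inl i) = f (Sum.inl i) * f x)
    (ho : ∀ i j, f (Sum.inr i) * f (Sum.inr j) = -(f (Sum.inr j) * f (Sum.inr i)))
    (x : Gen) : lift f he ho (gen K x) = f x :=
  (RingQuot.liftAlgHom_mkAlgHom_apply K _ _ _).trans (FreeAlgebra.lift_ι_apply f x)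

lemma algHom_ext {A : Type*} [Ring A] [Algebra K A] {f g : FreeSuperComm K →ₐ[K] A}
    (h : ∀ x, f (gen K x) = g (gen K x)) : f = g :=
  RingQuot.ringQuot_ext' (S := K) (s := SuperCommRel K) f g
    (FreeAlgebra.hom_ext (funext h))

variable (K)

/-- The augmentation, sending every generator to `0`. -/
def aug : FreeSuperComm K →ₐ[K] K := lift (fun _ => 0) (by simp) (by simp)

/-- The augmentation ideal `ω`, as a `K`-subspace. -/
def augIdeal : Submodule K (FreeSuperComm K) := LinearMap.ker (aug K).toLinearMap

variable {K}

lemma mem_augIdeal {a : FreeSuperComm K} : a ∈ augIdeal K ↔ aug K a = 0 := Iff.rfl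

lemma aug_gen (x : Gen) : aug K (gen K x) = 0 := lift_gen _ _ _ x

lemma gen_mem (x : Gen) : gen K x ∈ augIdeal K := aug_gen x

variable (K)

/-- The parity automorphism `y ↦ y`, `z ↦ -z`: it is `a ↦ (-1)^{parity of a} a` on
homogeneous elements, so that (in characteristic different from `2`) its eigenspaces for
`1` and `-1` are the even and the odd component. -/
def parity : FreeSuperComm K →ₐ[K] FreeSuperComm K :=
  lift (Sum.elim (fun i => gen K (Sum.inl i)) (fun i => -gen K (Sum.inr i)))
    (by
      rintro (x | x) i
      · exact gen_even_comm _ _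
      · simp only [Sum.elim_inl, Sum.elim_inr, neg_mul, mul_neg]
        rw [gen_even_comm])
    (by
      intro i j
      simp only [Sum.elim_inr, neg_mul, mul_neg, neg_neg]
      exact gen_odd_anticomm i j)

/-- The action on the free super-commutative algebra of a pair of maps of the indices:
`y_i ↦ y_{φ i}`, `z_i ↦ z_{ψ i}`. -/
def rename (φ ψ : ℕ → ℕ) : FreeSuperComm K →ₐ[K] FreeSuperComm K :=
  lift (fun x => gen K (Sum.map φ ψ x))
    (fun x i => gen_even_comm (Sum.map φ ψ x) (φ i))
    (fun i j => gen_odd_anticomm (ψ i) (ψ j))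

variable {K}

lemma parity_even (i : ℕ) : parity K (gen K (Sum.inl i)) = gen K (Sum.inl i) := by
  simp [parity]

lemma parity_odd (i : ℕ) : parity K (gen K (Sum.inr i)) = -gen K (Sum.inr i) := by
  simp [parity]

lemma rename_gen (φ ψ : ℕ → ℕ) (x : Gen) :
    rename K φ ψ (gen K x) = gen K (Sum.map φ ψ x) :=
  lift_gen _ _ _ x

lemma aug_parity (a : FreeSuperComm K) : aug K (parity K a) = aug K a := by
  have h : (aug K).comp (parity K) = aug K :=
    algHom_ext (by
      rintro (x | x)
      · rw [AlgHom.comp_apply, parity_even]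
      · rw [AlgHom.comp_apply, parity_odd, map_neg, aug_gen, neg_zero])
  exact DFunLike.congr_fun h a

lemma aug_rename (φ ψ : ℕ → ℕ) (a : FreeSuperComm K) :
    aug K (rename K φ ψ a) = aug K a := by
  have h : (aug K).comp (rename K φ ψ) = aug K := algHom_ext (fun x => by
    rw [AlgHom.comp_apply, rename_gen, aug_gen, aug_gen])
  exact DFunLike.congr_fun h a

variable (K)

/-- The linear map `KX → ω` sending generators to generators. -/
def genLin : (Gen →₀ K) →ₗ[K] augIdeal K :=
  Finsupp.linearCombination K (fun x => (⟨gen K x, gen_mem x⟩ : augIdeal K))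

/-- The multiplication of `ω`. -/
def omegaMul : augIdeal K →ₗ[K] augIdeal K →ₗ[K] augIdeal K :=
  LinearMap.mk₂ K
    (fun u v => ⟨(u : FreeSuperComm K) * v, by
      rw [mem_augIdeal, map_mul, mem_augIdeal.1 u.2, zero_mul]⟩)
    (fun a b c => Subtype.ext (add_mul (a : FreeSuperComm K) b c))
    (fun r a b => Subtype.ext (smul_mul_assoc r (a : FreeSuperComm K) b))
    (fun a b c => Subtype.ext (mul_add (a : FreeSuperComm K) b c))
    (fun r a b => Subtype.ext (mul_smul_comm r (a : FreeSuperComm K) b))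

/-- The parity automorphism restricted to `ω`. -/
def omegaParity : augIdeal K →ₗ[K] augIdeal K :=
  (parity K).toLinearMap.restrict (fun a ha => by
    rw [mem_augIdeal] at ha ⊢; exact (aug_parity a).trans ha)

/-- The projection of `ω` onto its even component. -/
def evenProj : augIdeal K →ₗ[K] augIdeal K := (2 : K)⁻¹ • (LinearMap.id + omegaParity K)

/-- The projection of `ω` onto its odd component. -/
def oddProj : augIdeal K →ₗ[K] augIdeal K := (2 : K)⁻¹ • (LinearMap.id - omegaParity K)

/-- The action of a pair of index maps restricted to `ω`. -/
def omegaRename (φ ψ : ℕ → ℕ) : augIdeal K →ₗ[K] augIdeal K :=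
  (rename K φ ψ).toLinearMap.restrict (fun a ha => by
    rw [mem_augIdeal] at ha ⊢; exact (aug_rename φ ψ a).trans ha)

/-- The vector space `KX ⊕ ω ⊗ ω` of the superalgebra `G_sup(X)`. Its multiplication is
`GSup.mul` below (never the componentwise one). -/
abbrev GSup : Type _ := (Gen →₀ K) × (augIdeal K ⊗[K] augIdeal K)

/-- The product on `ω ⊗ ω`:
`(u₁ ⊗ v₁) ∘ (u₂ ⊗ v₂) = (-1)^{|v₁| (|u₂| + |v₂|)} (u₁ u₂) ⊗ (v₂ v₁)`, obtained by splitting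
`v₁` into its even part (no sign) and its odd part (the sign `(-1)^{|u₂| + |v₂|}` is the parity
automorphism applied to `u₂` and `v₂`); see `squareMul_tmul_of_homogeneous`. -/
def squareMul : (augIdeal K ⊗[K] augIdeal K) →ₗ[K] (augIdeal K ⊗[K] augIdeal K) →ₗ[K]
    (augIdeal K ⊗[K] augIdeal K) :=
  TensorProduct.map₂ (omegaMul K) ((omegaMul K).flip ∘ₗ evenProj K) +
  TensorProduct.map₂ ((omegaMul K).compl₂ (omegaParity K))
    (((omegaMul K).flip ∘ₗ oddProj K).compl₂ (omegaParity K))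

/-- The multiplication `∘` of `G_sup(X)`; for `a, b ∈ KX` and `s, t ∈ ω ⊗ ω`,
`(a + s) ∘ (b + t) = a ⊗ b + a ∘ t + s ∘ b + s ∘ t`, where
`a ∘ (u ⊗ v) = (a u) ⊗ v` and `(u ⊗ v) ∘ b = u ⊗ (v b)`. -/
def GSup.mul (f g : GSup K) : GSup K :=
  (0, genLin K f.1 ⊗ₜ[K] genLin K g.1
    + (omegaMul K (genLin K f.1)).rTensor (augIdeal K) g.2
    + ((omegaMul K).flip (genLin K g.1)).lTensor (augIdeal K) f.2
    + squareMul K f.2 g.2)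

/-- The action of a pair of index maps on `G_sup(X)`. -/
def GSup.act (φ ψ : ℕ → ℕ) : GSup K →ₗ[K] GSup K :=
  LinearMap.prodMap (Finsupp.lmapDomain K K (Sum.map φ ψ))
    (TensorProduct.map (omegaRename K φ ψ) (omegaRename K φ ψ))

variable {K}

/-- The multiplication rule of `G_sup(X)²` on homogeneous elements of `ω`: `v₁`, `u₂`, `v₂` have
parities `a`, `b`, `c`. -/
lemma squareMul_tmul_of_homogeneous (h2 : (2 : K) ≠ 0) (a b c : ℕ)
    (u₁ v₁ u₂ v₂ : augIdeal K)
    (hv₁ : omegaParity K v₁ = (-1 : K) ^ a • v₁)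
    (hu₂ : omegaParity K u₂ = (-1 : K) ^ b • u₂)
    (hv₂ : omegaParity K v₂ = (-1 : K) ^ c • v₂) :
    squareMul K (u₁ ⊗ₜ v₁) (u₂ ⊗ₜ v₂) =
      (-1 : K) ^ (a * (b + c)) • (omegaMul K u₁ u₂ ⊗ₜ[K] omegaMul K v₂ v₁) := by
  have e : ∀ v : augIdeal K, (2 : K)⁻¹ • (v + v) = v := fun v => by
    rw [← two_smul K v, smul_smul, inv_mul_cancel₀ h2, one_smul]
  rcases Nat.even_or_odd a with ha | ha
  · have h1 : omegaParity K v₁ = v₁ := by rw [hv₁, ha.neg_one_pow, one_smul]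
    have h3 : evenProj K v₁ = v₁ := by simp [evenProj, h1, e, -smul_add]
    have h4 : oddProj K v₁ = 0 := by simp [oddProj, h1]
    simp [squareMul, h3, h4, pow_mul, ha.neg_one_pow]
  · have h1 : omegaParity K v₁ = -v₁ := by rw [hv₁, ha.neg_one_pow]; exact neg_one_smul K v₁
    have h3 : evenProj K v₁ = 0 := by simp [evenProj, h1]
    have h4 : oddProj K v₁ = v₁ := by simp [oddProj, h1, e, -smul_add]
    simp [squareMul, h3, h4, pow_mul, ha.neg_one_pow, hu₂, hv₂, TensorProduct.smul_tmul',
      TensorProduct.tmul_smul, smul_smul, pow_add, mul_comm]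

/-- `I` is a two-sided ideal of the algebra `G_sup(X)`. -/
def IsTwoSidedIdeal (I : Submodule K (GSup K)) : Prop :=
  ∀ f ∈ I, ∀ g : GSup K, GSup.mul K g f ∈ I ∧ GSup.mul K f g ∈ I

/-- `I` is a `Φ`-ideal: a two-sided ideal invariant under the semigroup `Φ = Φ_Y × Φ_Z` of
pairs of (strictly) order-preserving maps of the indices. -/
def IsPhiIdeal (I : Submodule K (GSup K)) : Prop :=
  IsTwoSidedIdeal I ∧
    ∀ φ ψ : ℕ → ℕ, StrictMono φ → StrictMono ψ → ∀ f ∈ I, GSup.act K φ ψ f ∈ I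

end

end Bicommutative

end

/-! The action of `F ⊗ F` on `ω ⊗ ω` given by `x ∘ w` and `w ∘ x` for generators `x`, together with
the index maps `Φ`, already makes `ω ⊗ ω` noetherian, so no other product is needed. The reason is
a Gröbner basis argument in which signs and vanishing products are harmless.

`ω ⊗ ω` is spanned by the elements `squareMon (p, q) = omegaMon p ⊗ omegaMon q`, where `p` and `q`
are nonempty multisets of generators. These elements are not linearly independent, as the square of
an odd generator vanishes when `2` is invertible, but independence is not used. The maps `x ∘ _`,
`_ ∘ x` and `(φ, ψ)` send each `squareMon m` to a nonzero multiple of `squareMon (τ m)`, where `τ`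
adds `x` to a component or renames the generators. Each such `τ` is strictly increasing for the
well-order `squareRank`, the lexicographic product of two colexicographic orders; comparing
exponents at the largest generator where they differ is what makes the order invariant under
increasing index maps (`rank_map_lt`).

By Higman's lemma, divisibility of monomials up to increasing index maps is a well-quasi-order
(`wellQuasiOrdered_map_le`): a pair of multisets is encoded by two words over `ℕ × ℕ`, one listing
the exponents of `y_0, y_1, …` in both components, the other those of `z_0, z_1, …`. Hence finitely
many leading monomials of an invariant subspace divide all the others, and reduction by elements
with these leading monomials terminates (`exists_finset_generating`).

The same argument applied to the image of `I` in `KX`, with `Φ` alone acting, gives finitely many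
elements of `I` that generate it modulo `I ∩ (ω ⊗ ω)`. -/

open scoped TensorProduct

namespace Bicommutative

/-! ### Leading monomials and a noetherianity criterion -/

section MonomialMaps

variable {K W M L : Type*} [Field K] [AddCommMonoid W] [Module K W] [LinearOrder L]

/-- The linear map `t` sends each element `e m` of the family `e` to a nonzero multiple of
`e (τ m)`, where `τ` is strictly increasing for the ordering of the indices by `rank`. The family
`e` need not be linearly independent. -/
structure IsMonomialMap (e : M → W) (rank : M → L) (t : W →ₗ[K] W) (τ : M → M) : Prop where
  lt_of_lt : ∀ m n, rank m < rank n → rank (τ m) < rank (τ n)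
  apply_eq : ∀ m, ∃ ε : K, ε ≠ 0 ∧ t (e m) = ε • e (τ m)

lemma IsMonomialMap.comp {e : M → W} {rank : M → L} {s t : W →ₗ[K] W} {σ τ : M → M}
    (hs : IsMonomialMap e rank s σ) (ht : IsMonomialMap e rank t τ) :
    IsMonomialMap e rank (s ∘ₗ t) (σ ∘ τ) where
  lt_of_lt m n h := hs.lt_of_lt _ _ (ht.lt_of_lt _ _ h)
  apply_eq m := by
    obtain ⟨ε, hε, h⟩ := ht.apply_eq m
    obtain ⟨δ, hδ, h'⟩ := hs.apply_eq (τ m)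
    exact ⟨ε * δ, mul_ne_zero hε hδ, by simp [h, h', smul_smul]⟩

/-- `m` divides `m'` with respect to a set `T` of linear maps: some member of `T` is a monomial map
whose underlying index map sends `m` to `m'`. -/
def MonomialDvd (e : M → W) (rank : M → L) (T : Set (W →ₗ[K] W)) (m m' : M) : Prop :=
  ∃ t ∈ T, ∃ τ, IsMonomialMap e rank t τ ∧ τ m = m'

/-- For a well-quasi-order, every set has a finite subset below each of its elements. -/
lemma exists_finset_forall_rel {r : M → M → Prop} (hr : WellQuasiOrdered r) (A : Set M) :
    ∃ B : Finset M, (∀ b ∈ B, b ∈ A) ∧ ∀ a ∈ A, ∃ b ∈ B, r b a := by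
  by_contra! hcon
  obtain ⟨f, -, hf⟩ := exists_seq_of_forall_finset_exists (· ∈ A) (fun x y => ¬ r x y)
    (fun s hs => hcon s hs)
  obtain ⟨i, j, hij, h⟩ := hr f
  exact hf i j hij h

/-- A nonzero element of a span of monomials has a largest monomial in some expression. -/
lemma eq_zero_or_mem_span_of_mem_span (e : M → W) (rank : M → L) {s : Set M} {f : W}
    (hf : f ∈ Submodule.span K (e '' s)) :
    f = 0 ∨ ∃ m ∈ s, f ∈ Submodule.span K (e '' {n | rank n ≤ rank m}) := by
  induction hf using Submodule.span_induction with
  | mem x hx =>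
    obtain ⟨m, hm, rfl⟩ := hx
    exact Or.inr ⟨m, hm, Submodule.subset_span ⟨m, le_rfl, rfl⟩⟩
  | zero => exact Or.inl rfl
  | add x y _ _ hx hy =>
    rcases hx with rfl | ⟨m, hm, hx⟩
    · simpa using hy
    rcases hy with rfl | ⟨n, hn, hy⟩
    · simpa using Or.inr ⟨m, hm, hx⟩
    have mono : ∀ {a b : M}, rank a ≤ rank b → Submodule.span K (e '' {n | rank n ≤ rank a}) ≤
        Submodule.span K (e '' {n | rank n ≤ rank b}) := fun h =>
      Submodule.span_mono (Set.image_mono fun _ hk => le_trans hk h)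
    rcases le_total (rank m) (rank n) with h | h
    · exact Or.inr ⟨n, hn, add_mem (mono h hx) hy⟩
    · exact Or.inr ⟨m, hm, add_mem hx (mono h hy)⟩
  | smul a x _ hx =>
    rcases hx with rfl | ⟨m, hm, hx⟩
    · exact Or.inl (smul_zero a)
    · exact Or.inr ⟨m, hm, Submodule.smul_mem _ a hx⟩

/-- If the family `e` spans and divisibility with respect to `T` is a well-quasi-order, every
`T`-invariant subspace is generated, as a `T`-invariant subspace, by a finite subset. An index `m`
counts as leading for `N` if `N` contains an element `e m + (terms of smaller rank)`; the generators
are such elements for finitely many `m` that divide all leading indices. -/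
theorem exists_finset_generating [WellFoundedLT L] (e : M → W) (rank : M → L)
    (hrank : Function.Injective rank) (he : Submodule.span K (Set.range e) = ⊤)
    (T : Set (W →ₗ[K] W)) (hT : WellQuasiOrdered (MonomialDvd e rank T))
    (N : Submodule K W) (hN : ∀ t ∈ T, ∀ f ∈ N, t f ∈ N) :
    ∃ S : Finset W, (∀ f ∈ S, f ∈ N) ∧ ∀ J : Submodule K W, (∀ f ∈ S, f ∈ J) →
      (∀ t ∈ T, ∀ f ∈ J, t f ∈ J) → N ≤ J := by
  classical
  -- `W` is only assumed to be an additive monoid because the instance carried by the tensor product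
  -- in `GSup` is not reducibly the one coming from its group structure.
  let _ : AddCommGroup W := Module.addCommMonoidToAddCommGroup K
  obtain ⟨B, hBA, hB⟩ := exists_finset_forall_rel hT
    {m | ∃ f : W, f ∈ N ∧ f - e m ∈ Submodule.span K (e '' {n | rank n < rank m})}
  choose! F hFN hF using hBA
  refine ⟨B.image F, Finset.forall_mem_image.2 hFN, fun J hSJ hJ => ?_⟩
  have key : ∀ l : L, ∀ m, rank m = l → ∀ f ∈ N,
      f ∈ Submodule.span K (e '' {n | rank n ≤ rank m}) → f ∈ J := by
    intro l
    induction l using WellFoundedLT.induction with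
    | ind l ih =>
    rintro m rfl f hfN hf
    -- In `hf` the coefficient of `e m` may vanish; otherwise `m` is leading and is cancelled below.
    have lower : ∀ g ∈ N, g ∈ Submodule.span K (e '' {n | rank n < rank m}) → g ∈ J := by
      intro g hgN hg
      rcases eq_zero_or_mem_span_of_mem_span e rank hg with rfl | ⟨n, hn, hg⟩
      · exact zero_mem J
      · exact ih _ hn n rfl g hgN hg
    have hset : {n | rank n ≤ rank m} = insert m {n | rank n < rank m} := by
      ext n
      simp [le_iff_lt_or_eq, hrank.eq_iff, or_comm]
    rw [hset, Set.image_insert_eq, Submodule.mem_span_insert] at hf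
    obtain ⟨a, g, hg, rfl⟩ := hf
    rcases eq_or_ne a 0 with rfl | ha
    · rw [zero_smul, zero_add] at hfN ⊢
      exact lower g hfN hg
    obtain ⟨b, hbB, t, htT, τ, ht, rfl⟩ := hB m ⟨(a⁻¹ • (a • e m + g) : W), N.smul_mem _ hfN, by
      rw [smul_add, inv_smul_smul₀ ha, add_sub_cancel_left]
      exact Submodule.smul_mem _ _ hg⟩
    obtain ⟨ε, hε, hεe⟩ := ht.apply_eq b
    have htF : t (F b) - ε • e (τ b) ∈ Submodule.span K (e '' {n | rank n < rank (τ b)}) := by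
      rw [← hεe, ← map_sub]
      have hle : Submodule.span K (e '' {n | rank n < rank b}) ≤
          (Submodule.span K (e '' {n | rank n < rank (τ b)})).comap t := by
        rw [Submodule.span_le]
        rintro _ ⟨n, hn, rfl⟩
        obtain ⟨δ, -, hδ⟩ := ht.apply_eq n
        rw [SetLike.mem_coe, Submodule.mem_comap, hδ]
        exact Submodule.smul_mem _ _ (Submodule.subset_span ⟨_, ht.lt_of_lt _ _ hn, rfl⟩)
      exact hle (hF b hbB)
    have hFJ : t (F b) ∈ J := hJ t htT _ (hSJ _ (Finset.mem_image_of_mem F hbB))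
    have hFN' : t (F b) ∈ N := hN t htT _ (hFN b hbB)
    have hdiff : a • e (τ b) + g - (a * ε⁻¹) • t (F b) ∈ J := by
      refine lower _ (sub_mem hfN (N.smul_mem _ hFN')) ?_
      have hrw : a • e (τ b) + g - (a * ε⁻¹) • t (F b) =
          g - (a * ε⁻¹) • (t (F b) - ε • e (τ b)) := by
        rw [smul_sub, smul_smul, mul_assoc, inv_mul_cancel₀ hε, mul_one]
        abel
      rw [hrw]
      exact sub_mem hg (Submodule.smul_mem _ _ htF)
    simpa using add_mem hdiff (J.smul_mem (a * ε⁻¹) hFJ)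
  intro f hf
  have hft : f ∈ Submodule.span K (e '' Set.univ) := by
    rw [Set.image_univ, he]
    trivial
  rcases eq_zero_or_mem_span_of_mem_span e rank hft with rfl | ⟨m, -, hm⟩
  · exact zero_mem J
  · exact key _ m rfl f hf hm

end MonomialMaps

/-! ### Well-quasi-order of pairs of monomials -/

lemma map_le_of_count_le {f : Gen → Gen} (hf : Function.Injective f) {p q : Multiset Gen}
    (h : ∀ x, p.count x ≤ q.count (f x)) : p.map f ≤ q := by
  rw [Multiset.le_iff_count]
  intro y
  by_cases hy : y ∈ Set.range f
  · obtain ⟨x, rfl⟩ := hy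
    rw [Multiset.count_map_eq_count' f p hf]
    exact h x
  · rw [Multiset.count_eq_zero_of_notMem]
    · exact Nat.zero_le _
    · intro hmem
      obtain ⟨x, -, rfl⟩ := Multiset.mem_map.1 hmem
      exact hy ⟨x, rfl⟩

/-- A strict upper bound for the indices of the generators occurring in a pair of multisets. -/
def indexBound (m : Multiset Gen × Multiset Gen) : ℕ :=
  ((m.1 + m.2).map (Sum.elim id id)).sum + 1

lemma lt_indexBound {m : Multiset Gen × Multiset Gen} {x : Gen} (h : x ∈ m.1 + m.2) :
    Sum.elim id id x < indexBound m :=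
  Nat.lt_succ_of_le (Multiset.le_sum_of_mem (Multiset.mem_map_of_mem _ h))

/-- The word whose `i`-th letter lists the exponents of the generator `ι i` in a pair of
multisets, where `ι` is `Sum.inl` or `Sum.inr`. -/
def word (ι : ℕ → Gen) (m : Multiset Gen × Multiset Gen) : List (ℕ × ℕ) :=
  (List.range (indexBound m)).map fun i => (m.1.count (ι i), m.2.count (ι i))

/-- An embedding of words in the sense of Higman's lemma extends to an increasing map of all indices
that does not decrease exponents. -/
lemma exists_strictMono_of_word {ι : ℕ → Gen} (hι : ∀ i, Sum.elim id id (ι i) = i)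
    {m m' : Multiset Gen × Multiset Gen}
    (h : List.SublistForall₂ (· ≤ ·) (word ι m) (word ι m')) :
    ∃ φ : ℕ → ℕ, StrictMono φ ∧ ∀ i, m.1.count (ι i) ≤ m'.1.count (ι (φ i)) ∧
      m.2.count (ι i) ≤ m'.2.count (ι (φ i)) := by
  obtain ⟨l, hl, hsub⟩ := List.sublistForall₂_iff.1 h
  obtain ⟨φ, hφ⟩ := List.sublist_iff_exists_orderEmbedding_getElem?_eq.1 hsub
  refine ⟨φ, φ.strictMono, fun i => ?_⟩
  by_cases hi : i < indexBound m
  · have hiw : i < (word ι m).length := by simpa [word] using hi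
    have hil : i < l.length := hl.length_eq ▸ hiw
    have hle := hl.get hiw hil
    have hi' := hφ i
    rw [List.getElem?_eq_getElem hil, eq_comm, List.getElem?_eq_some_iff] at hi'
    obtain ⟨hlt, heq⟩ := hi'
    simp only [List.get_eq_getElem] at hle
    rw [← heq] at hle
    simpa [word] using hle
  · have h0 : ι i ∉ m.1 + m.2 := fun hmem => hi (by simpa [hι] using lt_indexBound hmem)
    rw [Multiset.mem_add, not_or] at h0
    simp [Multiset.count_eq_zero_of_notMem h0.1, Multiset.count_eq_zero_of_notMem h0.2]

lemma wellQuasiOrdered_sublistForall₂ :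
    WellQuasiOrdered (List.SublistForall₂ ((· ≤ ·) : ℕ × ℕ → ℕ × ℕ → Prop)) := by
  have h := Set.PartiallyWellOrderedOn.partiallyWellOrderedOn_sublistForall₂
    ((· ≤ ·) : ℕ × ℕ → ℕ × ℕ → Prop)
    (Set.partiallyWellOrderedOn_univ_iff.2 wellQuasiOrdered_le)
  rw [← Set.partiallyWellOrderedOn_univ_iff]
  exact h.mono (by simp)

lemma sumMap_injective {φ ψ : ℕ → ℕ} (hφ : StrictMono φ) (hψ : StrictMono ψ) :
    Function.Injective (Sum.map φ ψ) := hφ.injective.sumMap hψ.injective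

/-- Pairs of multisets of generators are well-quasi-ordered by componentwise inclusion up to
increasing index maps acting on both components simultaneously. -/
theorem wellQuasiOrdered_map_le :
    WellQuasiOrdered fun m m' : Multiset Gen × Multiset Gen =>
      ∃ φ ψ : ℕ → ℕ, StrictMono φ ∧ StrictMono ψ ∧
        m.1.map (Sum.map φ ψ) ≤ m'.1 ∧ m.2.map (Sum.map φ ψ) ≤ m'.2 := by
  intro f
  have hpre : IsPreorder (List (ℕ × ℕ)) (List.SublistForall₂ (· ≤ ·)) := {}
  obtain ⟨i, j, hij, hy, hz⟩ :=
    (wellQuasiOrdered_sublistForall₂.prod wellQuasiOrdered_sublistForall₂)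
      fun n => (word Sum.inl (f n), word Sum.inr (f n))
  obtain ⟨φ, hφ, hφc⟩ := exists_strictMono_of_word (fun _ => rfl) hy
  obtain ⟨ψ, hψ, hψc⟩ := exists_strictMono_of_word (fun _ => rfl) hz
  refine ⟨i, j, hij, φ, ψ, hφ, hψ, map_le_of_count_le (sumMap_injective hφ hψ) ?_,
    map_le_of_count_le (sumMap_injective hφ hψ) ?_⟩
  · rintro (x | x)
    exacts [(hφc x).1, (hψc x).1]
  · rintro (x | x)
    exacts [(hφc x).2, (hψc x).2]

/-! ### The monomial order -/

instance : WellFoundedLT (ℕ ⊕ₗ ℕ) := ⟨Sum.lex_wf wellFounded_lt wellFounded_lt⟩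

/-- The exponent vector of a multiset of generators, in the colexicographic order: the comparison
takes place at the largest generator with different exponents, where every odd generator is larger
than every even one. -/
noncomputable def rank (p : Multiset Gen) : Colex ((ℕ ⊕ₗ ℕ) →₀ ℕ) :=
  toColex (Multiset.toFinsupp (p.map toLex))

lemma rank_injective : Function.Injective rank := fun _ _ h =>
  Multiset.map_injective toLex.injective (Multiset.toFinsupp.injective (toColex.injective h))

lemma rank_apply (p : Multiset Gen) (x : Gen) : ofColex (rank p) (toLex x) = p.count x := by
  change Multiset.toFinsupp (p.map toLex) (toLex x) = _
  rw [Multiset.toFinsupp_apply, Multiset.count_map_eq_count' _ _ toLex.injective]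

lemma rank_lt_iff {p q : Multiset Gen} :
    rank p < rank q ↔ ∃ x : Gen, (∀ y : Gen, toLex x < toLex y → p.count y = q.count y) ∧
      p.count x < q.count x := by
  rw [Finsupp.Colex.lt_iff]
  simp only [toLex.surjective.forall, toLex.surjective.exists, rank_apply]

lemma rank_cons_lt {p q : Multiset Gen} (x : Gen) (h : rank p < rank q) :
    rank (x ::ₘ p) < rank (x ::ₘ q) := by
  obtain ⟨y, hy, hlt⟩ := rank_lt_iff.1 h
  exact rank_lt_iff.2 ⟨y, fun z hz => by simp only [Multiset.count_cons, hy z hz],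
    by simpa [Multiset.count_cons] using hlt⟩

lemma toLex_sumMap_lt_iff {φ ψ : ℕ → ℕ} (hφ : StrictMono φ) (hψ : StrictMono ψ) (x y : Gen) :
    toLex (Sum.map φ ψ x) < toLex (Sum.map φ ψ y) ↔ toLex x < toLex y := by
  rcases x with x | x <;> rcases y with y | y <;> simp [hφ.lt_iff_lt, hψ.lt_iff_lt]

lemma rank_map_lt {φ ψ : ℕ → ℕ} (hφ : StrictMono φ) (hψ : StrictMono ψ) {p q : Multiset Gen}
    (h : rank p < rank q) : rank (p.map (Sum.map φ ψ)) < rank (q.map (Sum.map φ ψ)) := by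
  have hinj := sumMap_injective hφ hψ
  obtain ⟨y, hy, hlt⟩ := rank_lt_iff.1 h
  refine rank_lt_iff.2 ⟨Sum.map φ ψ y, fun z hz => ?_, ?_⟩
  · by_cases hzr : z ∈ Set.range (Sum.map φ ψ)
    · obtain ⟨w, rfl⟩ := hzr
      rw [Multiset.count_map_eq_count' _ _ hinj, Multiset.count_map_eq_count' _ _ hinj]
      exact hy w ((toLex_sumMap_lt_iff hφ hψ _ _).1 hz)
    · have h0 : ∀ r : Multiset Gen, (r.map (Sum.map φ ψ)).count z = 0 := fun r =>
        Multiset.count_eq_zero_of_notMem fun hmem => by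
          obtain ⟨w, -, rfl⟩ := Multiset.mem_map.1 hmem
          exact hzr ⟨w, rfl⟩
      rw [h0, h0]
  · rwa [Multiset.count_map_eq_count' _ _ hinj, Multiset.count_map_eq_count' _ _ hinj]

/-! ### Monomials in the free super-commutative algebra -/

variable {K : Type*} [Field K]

lemma exists_gen_mul_gen (x y : Gen) :
    ∃ ε : K, ε ≠ 0 ∧ gen K x * gen K y = ε • (gen K y * gen K x) := by
  rcases x with i | i <;> rcases y with j | j
  · exact ⟨1, one_ne_zero, by rw [one_smul, gen_even_comm]⟩
  · exact ⟨1, one_ne_zero, by rw [one_smul, gen_even_comm]⟩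
  · exact ⟨1, one_ne_zero, by rw [one_smul, gen_even_comm]⟩
  · exact ⟨-1, neg_ne_zero.2 one_ne_zero, by rw [neg_one_smul, gen_odd_anticomm]⟩

lemma exists_prod_eq_of_perm {l l' : List Gen} (h : l.Perm l') :
    ∃ ε : K, ε ≠ 0 ∧ (l.map (gen K)).prod = ε • (l'.map (gen K)).prod := by
  induction h with
  | nil => exact ⟨1, one_ne_zero, (one_smul _ _).symm⟩
  | cons x _ ih =>
    obtain ⟨ε, hε, h⟩ := ih
    exact ⟨ε, hε, by simp [h]⟩
  | swap x y l =>
    obtain ⟨ε, hε, h⟩ := exists_gen_mul_gen (K := K) y x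
    exact ⟨ε, hε, by
      simp only [List.map_cons, List.prod_cons, ← mul_assoc, h, smul_mul_assoc]⟩
  | trans _ _ ih ih' =>
    obtain ⟨ε, hε, h⟩ := ih
    obtain ⟨δ, hδ, h'⟩ := ih'
    exact ⟨ε * δ, mul_ne_zero hε hδ, by rw [h, h', smul_smul]⟩

variable (K) in
/-- The product of the generators in the multiset `p`, in an arbitrarily chosen order. Another order
changes it by a sign only. It is `0` if an odd generator is repeated and `2` is invertible. -/
noncomputable def mon (p : Multiset Gen) : FreeSuperComm K := (p.toList.map (gen K)).prod

lemma exists_prod_eq_mon {l : List Gen} {p : Multiset Gen} (h : (l : Multiset Gen) = p) :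
    ∃ ε : K, ε ≠ 0 ∧ (l.map (gen K)).prod = ε • mon K p :=
  exists_prod_eq_of_perm (Multiset.coe_eq_coe.1 (by rw [h, Multiset.coe_toList]))

lemma exists_gen_mul_mon (x : Gen) (p : Multiset Gen) :
    ∃ ε : K, ε ≠ 0 ∧ gen K x * mon K p = ε • mon K (x ::ₘ p) := by
  simpa [mon] using exists_prod_eq_mon (K := K) (l := x :: p.toList) (p := x ::ₘ p)
    (by rw [← Multiset.cons_coe, Multiset.coe_toList])

lemma exists_mon_mul_gen (x : Gen) (p : Multiset Gen) :
    ∃ ε : K, ε ≠ 0 ∧ mon K p * gen K x = ε • mon K (x ::ₘ p) := by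
  simpa [mon] using exists_prod_eq_mon (K := K) (l := p.toList ++ [x]) (p := x ::ₘ p)
    (by rw [← Multiset.coe_add, Multiset.coe_toList, Multiset.coe_singleton, add_comm,
      Multiset.singleton_add])

lemma exists_mon_mul_mon (p q : Multiset Gen) :
    ∃ ε : K, ε ≠ 0 ∧ mon K p * mon K q = ε • mon K (p + q) := by
  simpa [mon] using exists_prod_eq_mon (K := K) (l := p.toList ++ q.toList) (p := p + q)
    (by rw [← Multiset.coe_add, Multiset.coe_toList, Multiset.coe_toList])

lemma exists_rename_mon (φ ψ : ℕ → ℕ) (p : Multiset Gen) :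
    ∃ ε : K, ε ≠ 0 ∧ rename K φ ψ (mon K p) = ε • mon K (p.map (Sum.map φ ψ)) := by
  have h := exists_prod_eq_mon (K := K) (l := p.toList.map (Sum.map φ ψ))
    (p := p.map (Sum.map φ ψ)) (by rw [← Multiset.map_coe, Multiset.coe_toList])
  simpa only [mon, map_list_prod, List.map_map, Function.comp_def, rename_gen] using h

lemma mon_mem_augIdeal {p : Multiset Gen} (hp : p ≠ 0) : mon K p ∈ augIdeal K := by
  obtain ⟨x, hx⟩ := Multiset.exists_mem_of_ne_zero hp
  rw [mem_augIdeal, mon, map_list_prod, List.prod_eq_zero_iff]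
  exact List.mem_map.2 ⟨gen K x, List.mem_map_of_mem (Multiset.mem_toList.2 hx), aug_gen x⟩

/-- Nonempty multisets of generators, the exponents of the monomials without constant term. -/
abbrev NonConst : Type := {p : Multiset Gen // p ≠ 0}

variable (K) in
/-- The monomial `mon K p` as an element of `ω`. -/
noncomputable def omegaMon (p : NonConst) : augIdeal K := ⟨mon K p.1, mon_mem_augIdeal p.2⟩

lemma adjoin_range_gen : Algebra.adjoin K (Set.range (gen K)) = ⊤ := by
  have hr : Set.range (gen K) = mk K '' Set.range (FreeAlgebra.ι K) := by
    rw [← Set.range_comp]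
    rfl
  rw [hr, ← AlgHom.map_adjoin, FreeAlgebra.adjoin_range_ι, Algebra.map_top,
    AlgHom.range_eq_top]
  exact RingQuot.mkAlgHom_surjective K _

lemma sub_algebraMap_aug_mem_span (a : FreeSuperComm K) :
    a - algebraMap K _ (aug K a) ∈ Submodule.span K (mon K '' {p | p ≠ 0}) := by
  have ha : a ∈ Algebra.adjoin K (Set.range (gen K)) := adjoin_range_gen (K := K) ▸ trivial
  have hmul : ∀ a ∈ Submodule.span K (mon K '' {p | p ≠ 0}),
      ∀ b ∈ Submodule.span K (mon K '' {p | p ≠ 0}),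
      a * b ∈ Submodule.span K (mon K '' {p | p ≠ 0}) := by
    intro a ha b hb
    have h := Submodule.mul_mem_mul ha hb
    rw [Submodule.span_mul_span] at h
    refine Submodule.span_le.2 ?_ h
    rintro _ ⟨_, ⟨p, hp, rfl⟩, _, ⟨q, -, rfl⟩, rfl⟩
    obtain ⟨ε, -, hε⟩ := exists_mon_mul_mon (K := K) p q
    change mon K p * mon K q ∈ _
    rw [hε]
    exact Submodule.smul_mem _ _ (Submodule.subset_span ⟨p + q, by simp_all, rfl⟩)
  induction ha using Algebra.adjoin_induction with
  | mem x hx =>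
    obtain ⟨x, rfl⟩ := hx
    rw [aug_gen, map_zero, sub_zero]
    obtain ⟨ε, -, hε⟩ := exists_prod_eq_mon (K := K) (l := [x]) rfl
    rw [List.map_singleton, List.prod_singleton] at hε
    rw [hε]
    exact Submodule.smul_mem _ _ (Submodule.subset_span ⟨_, by simp, rfl⟩)
  | algebraMap r => simp
  | add a b _ _ ha hb =>
    rw [map_add, map_add, add_sub_add_comm]
    exact add_mem ha hb
  | mul a b _ _ ha hb =>
    have h := add_mem (add_mem (hmul _ ha _ hb) (Submodule.smul_mem _ (aug K a) hb))
      (Submodule.smul_mem _ (aug K b) ha)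
    convert h using 1
    simp only [map_mul, Algebra.algebraMap_eq_smul_one, mul_sub, sub_mul, smul_sub,
      smul_mul_assoc, mul_smul_comm, one_mul, mul_one, smul_smul]
    rw [mul_comm (aug K b)]
    abel

lemma span_range_omegaMon : Submodule.span K (Set.range (omegaMon K)) = ⊤ := by
  rw [eq_top_iff]
  rintro ⟨a, ha⟩ -
  have h := sub_algebraMap_aug_mem_span a
  rw [mem_augIdeal.1 ha, map_zero, sub_zero] at h
  have himg : mon K '' {p | p ≠ 0} = (augIdeal K).subtype '' Set.range (omegaMon K) := by
    rw [← Set.range_comp, Set.image_eq_range]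
    rfl
  rw [himg, ← Submodule.map_span] at h
  obtain ⟨b, hb, hba⟩ := h
  rwa [show b = ⟨a, ha⟩ from Subtype.ext hba] at hb

/-! ### Monomials of `ω ⊗ ω` -/

variable (K) in
/-- The monomials of `ω ⊗ ω`. -/
noncomputable def squareMon (m : NonConst × NonConst) : augIdeal K ⊗[K] augIdeal K :=
  omegaMon K m.1 ⊗ₜ omegaMon K m.2

lemma span_range_squareMon : Submodule.span K (Set.range (squareMon K)) = ⊤ := by
  have h := Submodule.map₂_span_span K (TensorProduct.mk K (augIdeal K) (augIdeal K))
    (Set.range (omegaMon K)) (Set.range (omegaMon K))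
  rw [span_range_omegaMon, TensorProduct.map₂_mk_top_top_eq_top, Set.image2_range] at h
  exact h.symm

/-- The lexicographic product of the monomial orders on both tensor factors. -/
noncomputable def squareRank (m : NonConst × NonConst) :
    Colex ((ℕ ⊕ₗ ℕ) →₀ ℕ) ×ₗ Colex ((ℕ ⊕ₗ ℕ) →₀ ℕ) :=
  toLex (rank m.1.1, rank m.2.1)

lemma squareRank_injective : Function.Injective squareRank := by
  rintro ⟨p, q⟩ ⟨p', q'⟩ h
  have h' := Prod.ext_iff.1 (toLex.injective h)
  exact Prod.ext (Subtype.ext (rank_injective h'.1)) (Subtype.ext (rank_injective h'.2))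

lemma squareRank_lt_of_lt {f g : NonConst → NonConst}
    (hf : ∀ p q : NonConst, rank p.1 < rank q.1 → rank (f p).1 < rank (f q).1)
    (hg : ∀ p q : NonConst, rank p.1 < rank q.1 → rank (g p).1 < rank (g q).1)
    (m n : NonConst × NonConst) (h : squareRank m < squareRank n) :
    squareRank (Prod.map f g m) < squareRank (Prod.map f g n) := by
  rw [squareRank, squareRank, Prod.Lex.toLex_lt_toLex] at h ⊢
  rcases h with h | ⟨h, h'⟩
  · exact Or.inl (hf _ _ h)
  · have he : m.1 = n.1 := Subtype.ext (rank_injective h)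
    exact Or.inr ⟨by simp [he], hg _ _ h'⟩

/-- Multiplication of a monomial by a generator. -/
def NonConst.cons (x : Gen) (p : NonConst) : NonConst := ⟨x ::ₘ p.1, Multiset.cons_ne_zero⟩

/-- Renaming of the generators in a monomial. -/
def NonConst.map (f : Gen → Gen) (p : NonConst) : NonConst :=
  ⟨p.1.map f, fun h => p.2 (Multiset.map_eq_zero.1 h)⟩

variable (K) in
/-- The map `w ↦ x ∘ w` on `ω ⊗ ω`. -/
noncomputable def leftMul (x : Gen) :
    augIdeal K ⊗[K] augIdeal K →ₗ[K] augIdeal K ⊗[K] augIdeal K :=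
  (omegaMul K ⟨gen K x, gen_mem x⟩).rTensor (augIdeal K)

variable (K) in
/-- The map `w ↦ w ∘ x` on `ω ⊗ ω`. -/
noncomputable def rightMul (x : Gen) :
    augIdeal K ⊗[K] augIdeal K →ₗ[K] augIdeal K ⊗[K] augIdeal K :=
  ((omegaMul K).flip ⟨gen K x, gen_mem x⟩).lTensor (augIdeal K)

lemma isMonomialMap_leftMul (x : Gen) :
    IsMonomialMap (squareMon K) squareRank (leftMul K x) (Prod.map (NonConst.cons x) id) where
  lt_of_lt := squareRank_lt_of_lt (fun _ _ h => rank_cons_lt x h) (fun _ _ h => h)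
  apply_eq := by
    rintro ⟨p, q⟩
    obtain ⟨ε, hε, h⟩ := exists_gen_mul_mon (K := K) x p.1
    have h' : omegaMul K ⟨gen K x, gen_mem x⟩ (omegaMon K p) = ε • omegaMon K (p.cons x) :=
      Subtype.ext h
    exact ⟨ε, hε, by simp [leftMul, squareMon, h', TensorProduct.smul_tmul']⟩

lemma isMonomialMap_rightMul (x : Gen) :
    IsMonomialMap (squareMon K) squareRank (rightMul K x) (Prod.map id (NonConst.cons x)) where
  lt_of_lt := squareRank_lt_of_lt (fun _ _ h => h) (fun _ _ h => rank_cons_lt x h)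
  apply_eq := by
    rintro ⟨p, q⟩
    obtain ⟨ε, hε, h⟩ := exists_mon_mul_gen (K := K) x q.1
    have h' : omegaMul K (omegaMon K q) ⟨gen K x, gen_mem x⟩ = ε • omegaMon K (q.cons x) :=
      Subtype.ext h
    exact ⟨ε, hε, by simp [rightMul, squareMon, h', TensorProduct.tmul_smul]⟩

lemma isMonomialMap_rename {φ ψ : ℕ → ℕ} (hφ : StrictMono φ) (hψ : StrictMono ψ) :
    IsMonomialMap (squareMon K) squareRank
      (TensorProduct.map (omegaRename K φ ψ) (omegaRename K φ ψ))
      (Prod.map (NonConst.map (Sum.map φ ψ)) (NonConst.map (Sum.map φ ψ))) where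
  lt_of_lt := squareRank_lt_of_lt (fun _ _ h => rank_map_lt hφ hψ h)
    (fun _ _ h => rank_map_lt hφ hψ h)
  apply_eq := by
    rintro ⟨p, q⟩
    have key : ∀ p : NonConst, ∃ ε : K, ε ≠ 0 ∧
        omegaRename K φ ψ (omegaMon K p) = ε • omegaMon K (p.map (Sum.map φ ψ)) := fun p => by
      obtain ⟨ε, hε, h⟩ := exists_rename_mon (K := K) φ ψ p.1
      exact ⟨ε, hε, Subtype.ext h⟩
    obtain ⟨ε, hε, h⟩ := key p
    obtain ⟨δ, hδ, h'⟩ := key q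
    exact ⟨ε * δ, mul_ne_zero hε hδ, by
      simp [squareMon, h, h', ← TensorProduct.smul_tmul', smul_smul, mul_comm]⟩

/-! ### Operators preserving the ideals -/

variable (K) in
/-- The linear maps on `ω ⊗ ω` that preserve `J ∩ (ω ⊗ ω)` for every `Φ`-ideal `J`. -/
def idealOps : Set (augIdeal K ⊗[K] augIdeal K →ₗ[K] augIdeal K ⊗[K] augIdeal K) :=
  {t | ∀ J : Submodule K (GSup K), IsPhiIdeal J → ∀ w, ((0, w) : GSup K) ∈ J →
    ((0, t w) : GSup K) ∈ J}

lemma leftMul_mem_idealOps (x : Gen) : leftMul K x ∈ idealOps K := by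
  intro J hJ w hw
  have h := (hJ.1 _ hw (Finsupp.single x 1, 0)).1
  simpa [GSup.mul, genLin, leftMul] using h

lemma rightMul_mem_idealOps (x : Gen) : rightMul K x ∈ idealOps K := by
  intro J hJ w hw
  have h := (hJ.1 _ hw (Finsupp.single x 1, 0)).2
  simpa [GSup.mul, genLin, rightMul] using h

lemma rename_mem_idealOps {φ ψ : ℕ → ℕ} (hφ : StrictMono φ) (hψ : StrictMono ψ) :
    TensorProduct.map (omegaRename K φ ψ) (omegaRename K φ ψ) ∈ idealOps K := by
  intro J hJ w hw
  simpa [GSup.act] using hJ.2 φ ψ hφ hψ _ hw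

lemma monomialDvd_leftMul {m : NonConst × NonConst} {p q : NonConst} (x : Gen)
    (h : MonomialDvd (squareMon K) squareRank (idealOps K) m (p, q)) :
    MonomialDvd (squareMon K) squareRank (idealOps K) m (p.cons x, q) := by
  obtain ⟨t, ht, τ, hτ, he⟩ := h
  exact ⟨leftMul K x ∘ₗ t, fun J hJ w hw => leftMul_mem_idealOps x J hJ _ (ht J hJ w hw),
    _, (isMonomialMap_leftMul x).comp hτ, by simp [he]⟩

lemma monomialDvd_rightMul {m : NonConst × NonConst} {p q : NonConst} (x : Gen)
    (h : MonomialDvd (squareMon K) squareRank (idealOps K) m (p, q)) :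
    MonomialDvd (squareMon K) squareRank (idealOps K) m (p, q.cons x) := by
  obtain ⟨t, ht, τ, hτ, he⟩ := h
  exact ⟨rightMul K x ∘ₗ t, fun J hJ w hw => rightMul_mem_idealOps x J hJ _ (ht J hJ w hw),
    _, (isMonomialMap_rightMul x).comp hτ, by simp [he]⟩

/-- A property of `p` stable under multiplication by generators holds for all multiples of `p`. -/
lemma NonConst.induction_of_le {P : NonConst → Prop} {p : NonConst} (h0 : P p)
    (hcons : ∀ x q, P q → P (q.cons x)) (q : NonConst) (hle : p.1 ≤ q.1) : P q := by
  obtain ⟨q, hq⟩ := q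
  obtain ⟨c, rfl⟩ := Multiset.le_iff_exists_add.1 hle
  clear hle
  induction c using Multiset.induction with
  | empty => simpa using h0
  | cons x c ih =>
    have hne : p.1 + c ≠ 0 := fun h => p.2 (by simp_all)
    convert hcons x _ (ih hne) using 1
    exact Subtype.ext (Multiset.add_cons x _ c)

theorem wellQuasiOrdered_squareMon :
    WellQuasiOrdered (MonomialDvd (squareMon K) squareRank (idealOps K)) := by
  intro f
  obtain ⟨i, j, hij, φ, ψ, hφ, hψ, hl, hr⟩ :=
    wellQuasiOrdered_map_le fun n => ((f n).1.1, (f n).2.1)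
  refine ⟨i, j, hij, ?_⟩
  have h0 : MonomialDvd (squareMon K) squareRank (idealOps K) (f i)
      ((f i).1.map (Sum.map φ ψ), (f i).2.map (Sum.map φ ψ)) :=
    ⟨_, rename_mem_idealOps hφ hψ, _, isMonomialMap_rename hφ hψ, rfl⟩
  have h1 : MonomialDvd (squareMon K) squareRank (idealOps K) (f i)
      ((f j).1, (f i).2.map (Sum.map φ ψ)) :=
    NonConst.induction_of_le (P := fun p => MonomialDvd (squareMon K) squareRank (idealOps K)
      (f i) (p, (f i).2.map (Sum.map φ ψ))) h0 (fun x _ h => monomialDvd_leftMul x h) _ hl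
  exact NonConst.induction_of_le (P := fun q => MonomialDvd (squareMon K) squareRank (idealOps K)
      (f i) ((f j).1, q)) h1 (fun x _ h => monomialDvd_rightMul x h) _ hr

variable (K) in
/-- The action of `Φ` on `KX`. -/
def linearOps : Set ((Gen →₀ K) →ₗ[K] (Gen →₀ K)) :=
  {t | ∃ φ ψ : ℕ → ℕ, StrictMono φ ∧ StrictMono ψ ∧ t = Finsupp.lmapDomain K K (Sum.map φ ψ)}

theorem wellQuasiOrdered_gen :
    WellQuasiOrdered (MonomialDvd (fun x : Gen => Finsupp.single x (1 : K))
      (toLex : Gen → ℕ ⊕ₗ ℕ) (linearOps K)) := by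
  intro f
  obtain ⟨i, j, hij, φ, ψ, hφ, hψ, h, -⟩ := wellQuasiOrdered_map_le fun n => ({f n}, 0)
  refine ⟨i, j, hij, _, ⟨φ, ψ, hφ, hψ, rfl⟩, Sum.map φ ψ,
    ⟨fun x y => (toLex_sumMap_lt_iff hφ hψ x y).2, fun x => ⟨1, one_ne_zero, by simp⟩⟩, ?_⟩
  simpa [eq_comm] using h

end Bicommutative

theorem proposition5p4 {K : Type*} [Field K] (hK : ringChar K ≠ 2)
    (I : Submodule K (Bicommutative.GSup K)) (hI : Bicommutative.IsPhiIdeal I) :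
    ∃ S : Finset (Bicommutative.GSup K),
      IsLeast {J : Submodule K (Bicommutative.GSup K) |
        Bicommutative.IsPhiIdeal J ∧ (S : Set (Bicommutative.GSup K)) ⊆ J} I := by
  open Bicommutative in
  classical
  obtain ⟨A, hAI, hA⟩ := exists_finset_generating (fun x : Gen => Finsupp.single x (1 : K))
    (toLex : Gen → ℕ ⊕ₗ ℕ) toLex.injective
    (by simpa using (Finsupp.basisSingleOne (R := K) (ι := Gen)).span_eq) (linearOps K)
    wellQuasiOrdered_gen
    (I.map (LinearMap.fst K (Gen →₀ K) (augIdeal K ⊗[K] augIdeal K))) (by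
      rintro _ ⟨φ, ψ, hφ, hψ, rfl⟩ _ ⟨f, hf, rfl⟩
      exact ⟨_, hI.2 φ ψ hφ hψ f hf, rfl⟩)
  obtain ⟨B, hBI, hB⟩ := exists_finset_generating (squareMon K) squareRank squareRank_injective
    span_range_squareMon (idealOps K) wellQuasiOrdered_squareMon
    (I.comap (LinearMap.inr K (Gen →₀ K) (augIdeal K ⊗[K] augIdeal K)))
    (fun t ht w hw => ht I hI w hw)
  -- `g` lifts the generators of the image of `I` in `KX` back to `I`.
  choose! g hgI hg using hAI
  refine ⟨A.image g ∪ B.image (LinearMap.inr K (Gen →₀ K) (augIdeal K ⊗[K] augIdeal K)),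
    ⟨hI, ?_⟩, ?_⟩
  · intro f hf
    simp only [Finset.coe_union, Finset.coe_image, Set.mem_union, Set.mem_image,
      Finset.mem_coe] at hf
    rcases hf with ⟨a, ha, rfl⟩ | ⟨b, hb, rfl⟩
    exacts [hgI a ha, hBI b hb]
  rintro J ⟨hJ, hSJ⟩ f hf
  have hgJ : ∀ a ∈ A, g a ∈ J := fun a ha =>
    hSJ (Finset.mem_coe.2 (Finset.mem_union_left _ (Finset.mem_image_of_mem _ ha)))
  -- Intersecting with `I` keeps the difference `f - f'` below inside `I`.
  have hlin := hA ((I ⊓ J).map (LinearMap.fst K (Gen →₀ K) (augIdeal K ⊗[K] augIdeal K)))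
    (fun a ha => ⟨g a, ⟨hgI a ha, hgJ a ha⟩, hg a ha⟩) (by
      rintro _ ⟨φ, ψ, hφ, hψ, rfl⟩ _ ⟨f, hf, rfl⟩
      exact ⟨_, ⟨hI.2 φ ψ hφ hψ f hf.1, hJ.2 φ ψ hφ hψ f hf.2⟩, rfl⟩)
  have hsq := hB (J.comap (LinearMap.inr K (Gen →₀ K) (augIdeal K ⊗[K] augIdeal K)))
    (fun b hb => hSJ (Finset.mem_coe.2
      (Finset.mem_union_right _ (Finset.mem_image_of_mem _ hb)))) (fun t ht w hw => ht J hJ w hw)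
  obtain ⟨f', ⟨hfI, hfJ⟩, hff⟩ := hlin ⟨f, hf, rfl⟩
  -- Differences are written with `(-1) • _` since the additive structure of `GSup K` is not
  -- reducibly the one of an additive group.
  have hneg : ∀ {E : Type _} [AddCommMonoid E] [Module K E] (x : E), (-1 : K) • x + x = 0 :=
    fun x => by
      have h := add_smul (-1 : K) 1 x
      rwa [neg_add_cancel, zero_smul, one_smul, eq_comm] at h
  have hdiff : (-1 : K) • f' + f =
      LinearMap.inr K (Gen →₀ K) (augIdeal K ⊗[K] augIdeal K) ((-1 : K) • f'.2 + f.2) := by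
    refine Prod.ext ?_ rfl
    change (-1 : K) • f'.1 + f.1 = 0
    rw [show f'.1 = f.1 from hff]
    exact hneg f.1
  have hmem : (-1 : K) • f' + f ∈ J := by
    have hI' : (-1 : K) • f' + f ∈ I := add_mem (I.smul_mem _ hfI) hf
    rw [hdiff] at hI' ⊢
    exact hsq hI'
  have hfinal : f' + ((-1 : K) • f' + f) = f := by
    rw [← add_assoc, add_comm f', hneg, zero_add]
  exact hfinal ▸ add_mem hfJ hmem
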